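/- There exist universal constants $c_0,c_1,c_2>0$ such that the following holds. Let $a_1,\dots,a_m\in\mathbb{R}^n$ be random vectors whose $mn$ entries are i.i.d. $\mathcal{N}(0,1)$. If $m>c_0\,n\log n$, then with probability at least $1-c_1\exp(-c_2 m)$ the inequalities $$0.5\,\|z-x\|\;\le\;\theta_p\Big(\big\{\,\big||a_i^Tz|-|a_i^Tx|\big|\,\big\}_{i=1}^m\Big)\;\le\;0.8\,\|z-x\|\qquad\text{for } p\in\{0.49,\,0.5,\,0.51\}$$ hold simultaneously for all $z,x\in\mathbb{R}^n$ satisfying $\|z-x\|<\frac1{11}\|z\|$. Here $\|\cdot\|$ is the Euclidean norm and, for real samples $X_1,\dots,X_m$, $\theta_p(\{X_i\}_{i=1}^m)=\inf\{t\in\mathbb{R}:\ \frac1m\,\#\{i: X_i\le t\}\ge p\}$ is the sample $p$-quantile, i.e. the $p$-quantile of the empirical distribution. -/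

import Mathlib

open MeasureTheory ProbabilityTheory

/-- Generalized quantile function of a cumulative distribution function `F`:
`θ_p(F) = inf {t : F t ≥ p}` (meant for `0 < p < 1`). -/
noncomputable def quantile (F : ℝ → ℝ) (p : ℝ) : ℝ :=
  sInf {t : ℝ | p ≤ F t}

/-- Cumulative distribution function of the empirical distribution of the samples
`X 0, …, X (m - 1)`. -/
noncomputable def empiricalCDF {m : ℕ} (X : Fin m → ℝ) (t : ℝ) : ℝ :=
  (Nat.card {i : Fin m // X i ≤ t} : ℝ) / (m : ℝ)

/-- Sample `p`-quantile: the `p`-quantile of the empirical distribution. -/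
noncomputable def sampleQuantile {m : ℕ} (X : Fin m → ℝ) (p : ℝ) : ℝ :=
  quantile (empiricalCDF X) p

/-- The `m` random vectors `a i` of `ℝⁿ` have (jointly over all vectors and coordinates)
i.i.d. standard Gaussian entries. -/
structure IsStdGaussianDesign {Ω : Type*} [MeasurableSpace Ω] (P : Measure Ω) {m n : ℕ}
    (a : Fin m → Ω → EuclideanSpace ℝ (Fin n)) : Prop where
  hasLaw : ∀ (i : Fin m) (j : Fin n), HasLaw (fun ω => a i ω j) (gaussianReal 0 1) P
  indep : iIndepFun (fun (q : Fin m × Fin n) (ω : Ω) => a q.1 ω q.2) P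

/-! ### Numerical estimates for the standard Gaussian -/

section Gaussian

open Set

/-! Since `||α| - |β|| = min |α - β| |α + β|`, each sample is the smaller of the inner products of a
row with `z - x` and with `z + x`, and the hypothesis forces `‖z + x‖ ≥ 21 ‖z - x‖`. The second
rarely wins, so the quantiles are nearly those of `|g| ‖z - x‖`, `g` standard Gaussian.
`sampleQuantile_abs_abs_inner_sub_mem` thus reduces everything to counting, for every unit `u`, the
rows with `|⟨a i, u⟩|` below 0.5, 0.024 and 0.8.

For fixed `u` the counts concentrate by Hoeffding (`measure_card_filter_mem_ge_le`). Uniformity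
comes from a net (`exists_finset_net_sphere`) and a Markov bound for the rows that see the
displacement `u - w` (`card_filter_abs_inner_bounds`). That bound uses only `∑ ‖a i‖² ≤ 4mn`, so the
mesh must be of order `1/√n`; the net then has `exp(O(n log n))` points, whence the condition on
`m`. -/

lemma integral_Icc_symm_gaussianPDF (t : ℝ) (ht : 0 ≤ t) :
    (gaussianReal 0 1).real (Icc (-t) t) =
      (√(2 * Real.pi))⁻¹ * ∫ x in (-t)..t, Real.exp (-x ^ 2 / 2) := by
  rw [measureReal_def, gaussianReal_apply_eq_integral _ one_ne_zero, ENNReal.toReal_ofReal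
    (integral_nonneg fun x => gaussianPDFReal_nonneg _ _ _), integral_Icc_eq_integral_Ioc,
    ← intervalIntegral.integral_of_le (by linarith), ← intervalIntegral.integral_const_mul]
  simp [gaussianPDFReal]

lemma gaussianReal_Icc_symm_le {t : ℝ} (ht : 0 ≤ t) :
    (gaussianReal 0 1).real (Icc (-t) t) ≤ 0.8 * t := by
  rw [integral_Icc_symm_gaussianPDF t ht]
  have h1 : ∫ x in (-t)..t, Real.exp (-x ^ 2 / 2) ≤ ∫ _ in (-t)..t, (1 : ℝ) := by
    refine intervalIntegral.integral_mono_on (by linarith)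
      (Continuous.intervalIntegrable (by fun_prop) _ _) (by simp) fun x _ => ?_
    exact Real.exp_le_one_iff.2 (by nlinarith [sq_nonneg x])
  have h2 : (√(2 * Real.pi))⁻¹ ≤ 0.4 := by
    rw [inv_le_comm₀ (by positivity) (by norm_num)]
    exact Real.le_sqrt_of_sq_le (by norm_num; linarith [Real.pi_gt_d2])
  have h3 : ∫ _ in (-t)..t, (1 : ℝ) = 2 * t := by simp; ring
  rw [h3] at h1
  calc _ ≤ (√(2 * Real.pi))⁻¹ * (2 * t) := by gcongr
    _ ≤ 0.4 * (2 * t) := by gcongr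
    _ = _ := by ring

lemma le_gaussianReal_Icc_symm {t : ℝ} (ht : 0 ≤ t) :
    (√(2 * Real.pi))⁻¹ * (2 * (t - t ^ 3 / 6)) ≤ (gaussianReal 0 1).real (Icc (-t) t) := by
  rw [integral_Icc_symm_gaussianPDF t ht]
  gcongr
  have h1 : ∫ x in (-t)..t, (1 - x ^ 2 / 2) ≤ ∫ x in (-t)..t, Real.exp (-x ^ 2 / 2) := by
    refine intervalIntegral.integral_mono_on (by linarith)
      (Continuous.intervalIntegrable (by fun_prop) _ _)
      (Continuous.intervalIntegrable (by fun_prop) _ _) fun x _ => ?_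
    have := Real.add_one_le_exp (-x ^ 2 / 2)
    linarith
  refine le_trans (le_of_eq ?_) h1
  rw [intervalIntegral.integral_sub (by simp)
    (Continuous.intervalIntegrable (by fun_prop) _ _)]
  simp only [intervalIntegral.integral_div, integral_pow, intervalIntegral.integral_const]
  simp
  ring

lemma gaussianReal_compl_Icc_le : (gaussianReal 0 1).real (Icc (-0.79) 0.79)ᶜ ≤ 0.45 := by
  have h := le_gaussianReal_Icc_symm (t := 0.79) (by norm_num)
  have h2 : (0.398 : ℝ) ≤ (√(2 * Real.pi))⁻¹ := by
    rw [le_inv_comm₀ (by norm_num) (by positivity)]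
    exact (Real.sqrt_le_left (by norm_num)).2 (by norm_num; linarith [Real.pi_lt_d2])
  rw [probReal_compl_eq_one_sub measurableSet_Icc]
  nlinarith

lemma mgf_sq_gaussianReal : mgf (fun x : ℝ => x ^ 2) (gaussianReal 0 1) (1 / 4) = √2 := by
  rw [mgf, integral_gaussianReal_eq_integral_smul one_ne_zero]
  have h : ∀ x : ℝ, gaussianPDFReal 0 1 x • Real.exp (1 / 4 * x ^ 2) =
      (√(2 * Real.pi))⁻¹ * Real.exp (-(1 / 4) * x ^ 2) := by
    intro x
    simp only [gaussianPDFReal, smul_eq_mul]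
    rw [mul_assoc, ← Real.exp_add]
    simp
    left
    ring
  simp_rw [h]
  rw [integral_const_mul, integral_gaussian, ← Real.sqrt_inv, ← Real.sqrt_mul (by positivity)]
  congr 1
  field_simp
  norm_num

end Gaussian

/-! ### Hoeffding and chi-square tail bounds -/

section Concentration

variable {Ω : Type*} [MeasurableSpace Ω] {P : Measure Ω}

lemma measure_card_filter_mem_ge_le [IsProbabilityMeasure P] {m : ℕ} {X : Fin m → Ω → ℝ}
    {μ : Measure ℝ} [IsProbabilityMeasure μ]
    (hX : ∀ i, HasLaw (X i) μ P) (hind : iIndepFun X P) {S : Set ℝ} (hS : MeasurableSet S)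
    [DecidablePred (· ∈ S)] {p ε : ℝ} (hp : μ.real S ≤ p) (hε : 0 ≤ ε) :
    P.real {ω | (p + ε) * m ≤ (Finset.univ.filter fun i => X i ω ∈ S).card} ≤
      Real.exp (-2 * ε ^ 2 * m) := by
  set f : ℝ → ℝ := S.indicator 1 with hf
  have hfm : Measurable f := measurable_one.indicator hS
  have hmean : ∀ i, ∫ ω, f (X i ω) ∂P = μ.real S := by
    intro i
    have := (hX i).integral_comp (f := f) hfm.aestronglyMeasurable
    simp only [Function.comp_def] at this
    rw [this, hf, integral_indicator_one hS]
  have hsub : ∀ i ∈ Finset.univ, HasSubgaussianMGF (fun ω => f (X i ω) - μ.real S)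
      (((‖(1 : ℝ) - 0‖₊ / 2) ^ 2 : NNReal)) P := by
    intro i _
    rw [← hmean i]
    refine hasSubgaussianMGF_of_mem_Icc (hfm.comp_aemeasurable (hX i).aemeasurable)
      (ae_of_all _ fun ω => ?_)
    by_cases h : X i ω ∈ S <;> simp [hf, h]
  have hind' : iIndepFun (fun i ω => f (X i ω) - μ.real S) P :=
    hind.comp (fun _ x => f x - μ.real S) fun _ => hfm.sub_const _
  have key := HasSubgaussianMGF.measure_sum_ge_le_of_iIndepFun hind' hsub
    (ε := ε * m) (by positivity)
  refine (measureReal_mono fun ω hω => ?_).trans (key.trans (le_of_eq ?_))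
  · have hc : ((Finset.univ.filter fun i => X i ω ∈ S).card : ℝ) = ∑ i, f (X i ω) := by
      rw [Finset.card_filter]
      push_cast
      refine Finset.sum_congr rfl fun i _ => ?_
      by_cases h : X i ω ∈ S <;> simp [hf, h]
    simp only [Set.mem_ofPred_eq, hc] at hω ⊢
    rw [Finset.sum_sub_distrib]
    simp only [Finset.sum_const, Finset.card_univ, Fintype.card_fin, nsmul_eq_mul]
    have : (m : ℝ) * μ.real S ≤ m * p := by gcongr
    linarith
  · congr 1
    simp
    rcases eq_or_ne (m : ℝ) 0 with h | h
    · simp [h]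
    · field_simp

lemma measure_sum_sq_gaussian_ge_le {ι : Type*} [Fintype ι]
    {X : ι → Ω → ℝ} (hX : ∀ i, HasLaw (X i) (gaussianReal 0 1) P) (hind : iIndepFun X P) :
    P.real {ω | 4 * (Fintype.card ι : ℝ) ≤ ∑ i, X i ω ^ 2} ≤
      Real.exp (-(Fintype.card ι : ℝ) / 2) := by
  have := hind.isProbabilityMeasure
  have hind' : iIndepFun (fun i ω => X i ω ^ 2) P :=
    hind.comp (fun _ x => x ^ 2) fun _ => by fun_prop
  have hm : ∀ i, AEMeasurable (fun ω => X i ω ^ 2) P := fun i => (hX i).aemeasurable.pow_const 2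
  have hmgf : ∀ i, mgf (fun ω => X i ω ^ 2) P (1 / 4) = √2 := fun i => by
    rw [← mgf_sq_gaussianReal, ← (hX i).map_eq, mgf, mgf,
      integral_map (hX i).aemeasurable (by fun_prop)]
  -- Otherwise the mgf would take its default value 0, yet independence makes it a power of `√2`.
  have hI : Integrable (fun ω => Real.exp (1 / 4 * (∑ i, fun ω => X i ω ^ 2) ω)) P := by
    by_contra h
    have h0 := mgf_undef h
    rw [hind'.mgf_sum₀ hm] at h0
    simp only [hmgf] at h0
    simp at h0
  have key := measure_ge_le_exp_mul_mgf (4 * (Fintype.card ι : ℝ)) (by norm_num) hI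
  rw [hind'.mgf_sum₀ hm] at key
  simp only [hmgf, Finset.prod_const, Finset.card_univ, Finset.sum_apply] at key
  refine key.trans ?_
  have h2 : √2 ≤ Real.exp (1 / 2) := by
    refine (Real.sqrt_le_left (Real.exp_pos _).le).2 ?_
    rw [← Real.exp_nat_mul]
    norm_num
    linarith [Real.exp_one_gt_d9]
  calc _ ≤ Real.exp (-(1 / 4) * (4 * Fintype.card ι)) * Real.exp (1 / 2) ^ Fintype.card ι := by
        gcongr
    _ = _ := by
        rw [← Real.exp_nat_mul, ← Real.exp_add]
        ring_nf

end Concentration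

/-! ### Inner products of the rows with a fixed direction -/

section Design

variable {Ω : Type*} [MeasurableSpace Ω] {P : Measure Ω} {m n : ℕ}
  {a : Fin m → Ω → EuclideanSpace ℝ (Fin n)}

lemma inner_eq_sum_mul (u v : EuclideanSpace ℝ (Fin n)) :
    inner ℝ u v = ∑ j, v j * u j := by
  simp [PiLp.inner_apply]

namespace IsStdGaussianDesign

lemma hasGaussianLaw (ha : IsStdGaussianDesign P a) :
    HasGaussianLaw (fun ω (q : Fin m × Fin n) => a q.1 ω q.2) P :=
  ha.indep.hasGaussianLaw fun q => (ha.hasLaw q.1 q.2).hasGaussianLaw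

lemma covariance_entry [DecidableEq (Fin m × Fin n)] (ha : IsStdGaussianDesign P a)
    (q r : Fin m × Fin n) :
    cov[fun ω => a q.1 ω q.2, fun ω => a r.1 ω r.2; P] = if q = r then 1 else 0 := by
  have h2 (q : Fin m × Fin n) := (ha.hasLaw q.1 q.2).hasGaussianLaw.memLp_two
  split_ifs with h
  · subst h
    rw [covariance_self (ha.hasLaw _ _).aemeasurable, (ha.hasLaw q.1 q.2).variance_eq]
    simp
  · exact (ha.indep.indepFun h).covariance_eq_zero (h2 q) (h2 r)

lemma covariance_inner (ha : IsStdGaussianDesign P a) (w : EuclideanSpace ℝ (Fin n))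
    (i k : Fin m) :
    cov[fun ω => inner ℝ (a i ω) w, fun ω => inner ℝ (a k ω) w; P] =
      if i = k then ‖w‖ ^ 2 else 0 := by
  classical
  have h2 (i : Fin m) (j : Fin n) := (ha.hasLaw i j).hasGaussianLaw.memLp_two
  simp_rw [inner_eq_sum_mul]
  have := (ha.indep).isProbabilityMeasure
  rw [covariance_fun_sum_fun_sum (fun j => (h2 i j).const_mul _) fun j => (h2 k j).const_mul _]
  simp_rw [covariance_const_mul_left, covariance_const_mul_right]
  have (j l : Fin n) := ha.covariance_entry (i, j) (k, l)
  simp only at this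
  simp_rw [this]
  split_ifs with h
  · rw [EuclideanSpace.real_norm_sq_eq]
    simp [h, pow_two]
  · simp [h]

lemma hasGaussianLaw_inner (ha : IsStdGaussianDesign P a) (w : EuclideanSpace ℝ (Fin n)) :
    HasGaussianLaw (fun ω i => inner ℝ (a i ω) w) P := by
  let L : (Fin m × Fin n → ℝ) →L[ℝ] (Fin m → ℝ) :=
    ContinuousLinearMap.pi fun i => ∑ j, w j • ContinuousLinearMap.proj (i, j)
  have h : (fun ω i => inner ℝ (a i ω) w) = fun ω => L fun q => a q.1 ω q.2 := by
    ext ω i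
    simp [L, inner_eq_sum_mul]
  rw [h]
  exact ha.hasGaussianLaw.map_fun L

/-- Uncorrelated coordinates of a jointly Gaussian vector are independent. -/
lemma iIndepFun_inner (ha : IsStdGaussianDesign P a) (w : EuclideanSpace ℝ (Fin n)) :
    iIndepFun (fun i ω => inner ℝ (a i ω) w) P :=
  (ha.hasGaussianLaw_inner w).iIndepFun_of_covariance_eq_zero fun i k h => by
    rw [ha.covariance_inner, if_neg h]

lemma hasLaw_inner (ha : IsStdGaussianDesign P a) {w : EuclideanSpace ℝ (Fin n)}
    (hw : ‖w‖ = 1) (i : Fin m) :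
    HasLaw (fun ω => inner ℝ (a i ω) w) (gaussianReal 0 1) P := by
  have hG := (ha.hasGaussianLaw_inner w).eval i
  refine ⟨hG.aemeasurable, ?_⟩
  rw [hG.map_eq_gaussianReal]
  congr
  · simp_rw [inner_eq_sum_mul]
    rw [integral_finsetSum _ fun j _ => ((ha.hasLaw i j).hasGaussianLaw.integrable).const_mul _]
    refine Finset.sum_eq_zero fun j _ => ?_
    rw [integral_const_mul, (ha.hasLaw i j).integral_eq, integral_id_gaussianReal, mul_zero]
  · rw [← covariance_self hG.aemeasurable, ha.covariance_inner, if_pos rfl, hw]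
    simp

lemma measure_sum_norm_sq_ge_le (ha : IsStdGaussianDesign P a) :
    P.real {ω | 4 * ((m : ℝ) * n) ≤ ∑ i, ‖a i ω‖ ^ 2} ≤ Real.exp (-((m : ℝ) * n) / 2) := by
  have h := measure_sum_sq_gaussian_ge_le (X := fun (q : Fin m × Fin n) ω => a q.1 ω q.2)
    (fun q => ha.hasLaw q.1 q.2) ha.indep
  simpa [Fintype.sum_prod_type, EuclideanSpace.real_norm_sq_eq] using h

end IsStdGaussianDesign

end Design

/-! ### Quantile bounds from counts -/

section Quantile

variable {m : ℕ} {X : Fin m → ℝ} {p t : ℝ}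

lemma empiricalCDF_eq_card_filter (X : Fin m → ℝ) (t : ℝ) :
    empiricalCDF X t = ((Finset.univ.filter fun i => X i ≤ t).card : ℝ) / m := by
  rw [empiricalCDF, Nat.card_eq_fintype_card, Fintype.card_subtype]

/-- Nonnegative samples and `0 < p` bound the set below, as comparison with `sInf` requires. -/
lemma sampleQuantile_le (hX : ∀ i, 0 ≤ X i) (hp : 0 < p) (h : p ≤ empiricalCDF X t) :
    sampleQuantile X p ≤ t := by
  refine csInf_le ⟨0, fun s hs => ?_⟩ h
  by_contra! hs0
  have : (Finset.univ.filter fun i => X i ≤ s) = ∅ :=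
    Finset.filter_eq_empty_iff.2 fun i _ => by linarith [hX i]
  rw [Set.mem_ofPred_eq, empiricalCDF_eq_card_filter, this] at hs
  simp at hs
  linarith

lemma le_sampleQuantile (hm : 0 < m) (hp : p ≤ 1)
    (h : ∀ s < t, empiricalCDF X s < p) : t ≤ sampleQuantile X p := by
  refine le_csInf ⟨∑ i, |X i|, ?_⟩ fun s hs => ?_
  · have : (Finset.univ.filter fun i => X i ≤ ∑ i, |X i|) = Finset.univ :=
      Finset.filter_true_of_mem fun i _ => (le_abs_self _).trans
        (Finset.single_le_sum (f := fun i => |X i|) (fun _ _ => abs_nonneg _) (Finset.mem_univ i))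
    rw [Set.mem_ofPred_eq, empiricalCDF_eq_card_filter, this]
    simpa [hm.ne'] using hp
  · by_contra! hlt
    exact absurd (h s hlt) (not_lt.2 hs)

end Quantile

/-! ### A net of the unit sphere -/

section Net

variable {n : ℕ}

/-- Normalising moves `v` by `|‖v‖ - 1|`, itself at most `‖u - v‖`. -/
lemma norm_sub_inv_norm_smul_le {E : Type*} [NormedAddCommGroup E] [NormedSpace ℝ E] {u v : E}
    (hu : ‖u‖ = 1) (hv : v ≠ 0) : ‖u - ‖v‖⁻¹ • v‖ ≤ 2 * ‖u - v‖ := by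
  have h0 : ‖v‖ ≠ 0 := norm_ne_zero_iff.2 hv
  have h1 : ‖v - ‖v‖⁻¹ • v‖ = |‖v‖ - 1| := by
    have : v - ‖v‖⁻¹ • v = (1 - ‖v‖⁻¹) • v := by rw [sub_smul, one_smul]
    rw [this, norm_smul, Real.norm_eq_abs]
    nth_rewrite 2 [← abs_norm v]
    rw [← abs_mul, sub_mul, inv_mul_cancel₀ h0, one_mul]
  have h2 : |‖v‖ - 1| ≤ ‖u - v‖ := by
    rw [← hu, norm_sub_rev u v]
    exact abs_norm_sub_norm_le v u
  calc ‖u - ‖v‖⁻¹ • v‖ = ‖(u - v) + (v - ‖v‖⁻¹ • v)‖ := by congr 1; abel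
    _ ≤ ‖u - v‖ + ‖v - ‖v‖⁻¹ • v‖ := norm_add_le _ _
    _ ≤ 2 * ‖u - v‖ := by linarith

/-- A net of the unit sphere, obtained by normalising the points of a cubic grid. -/
lemma exists_finset_net_sphere {K : ℕ} (hK : 2 ≤ K) (hn : 0 < n) :
    ∃ N : Finset (EuclideanSpace ℝ (Fin n)), N.card ≤ (2 * (K * n) + 1) ^ n ∧
      (∀ w ∈ N, ‖w‖ = 1) ∧
      ∀ u : EuclideanSpace ℝ (Fin n), ‖u‖ = 1 →
        ∃ w ∈ N, ‖u - w‖ ^ 2 * ((K : ℝ) ^ 2 * n) ≤ 4 := by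
  classical
  let g : (Fin n → ℤ) → EuclideanSpace ℝ (Fin n) :=
    fun k => WithLp.toLp 2 fun j => (k j : ℝ) / (K * n)
  let G : Finset (Fin n → ℤ) :=
    Fintype.piFinset fun _ => Finset.Icc (-(K * n : ℕ) : ℤ) (K * n : ℕ)
  have hKn : (0 : ℝ) < K * n := by positivity
  have hn1 : (1 : ℝ) ≤ n := by exact_mod_cast hn
  have hK2 : (2 : ℝ) ≤ K := by exact_mod_cast hK
  refine ⟨((G.image g).filter (· ≠ 0)).image fun v => ‖v‖⁻¹ • v, ?_, ?_, ?_⟩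
  · refine Finset.card_image_le.trans ((Finset.card_filter_le _ _).trans
      (Finset.card_image_le.trans (le_of_eq ?_)))
    simp only [G, Fintype.card_piFinset_const, Int.card_Icc]
    congr 1
    omega
  · intro w hw
    obtain ⟨v, hv, rfl⟩ := Finset.mem_image.1 hw
    have h0 : ‖v‖ ≠ 0 := norm_ne_zero_iff.2 (Finset.mem_filter.1 hv).2
    rw [norm_smul, norm_inv, norm_norm, inv_mul_cancel₀ h0]
  · intro u hu
    let k : Fin n → ℤ := fun j => round (K * n * u j)
    have hcoord (j : Fin n) : |u j| ≤ 1 := by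
      rw [← hu]; exact PiLp.norm_apply_le u j
    have hk : k ∈ G := by
      refine Fintype.mem_piFinset.2 fun j => Finset.mem_Icc.2 ?_
      have h1 := abs_sub_round (K * n * u j)
      have h2 := abs_le.1 (hcoord j)
      rw [abs_le] at h1
      constructor
      · have : (-(K * n : ℕ) : ℝ) - 1 < (k j : ℝ) := by push_cast; simp only [k]; nlinarith
        have : (-(K * n : ℕ) : ℤ) - 1 < k j := by exact_mod_cast this
        omega
      · have : (k j : ℝ) < (K * n : ℕ) + 1 := by push_cast; simp only [k]; nlinarith
        have : k j < ((K * n : ℕ) : ℤ) + 1 := by exact_mod_cast this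
        omega
    -- Rounding costs at most `1 / (2Kn)` in each of the `n` coordinates.
    have hdist : ‖u - g k‖ ^ 2 * ((K : ℝ) ^ 2 * n) ≤ 1 / 4 := by
      have hj (j : Fin n) : ((u - g k) j) ^ 2 ≤ 1 / 4 / (K * n) ^ 2 := by
        have h1 := abs_sub_round (K * n * u j)
        have h2 : (u - g k) j = (K * n * u j - k j) / (K * n) := by
          simp only [PiLp.sub_apply, g]
          field_simp
        rw [h2, div_pow, ← sq_abs]
        have : |K * n * u j - k j| ^ 2 ≤ (1 / 2) ^ 2 := by gcongr
        gcongr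
        linarith
      have hs : ‖u - g k‖ ^ 2 ≤ n * (1 / 4 / (K * n) ^ 2) := by
        rw [EuclideanSpace.real_norm_sq_eq]
        refine (Finset.sum_le_sum fun j _ => hj j).trans (le_of_eq ?_)
        simp
      calc _ ≤ n * (1 / 4 / (K * n) ^ 2) * ((K : ℝ) ^ 2 * n) := by gcongr
        _ = 1 / 4 := by field_simp
    have hg0 : g k ≠ 0 := by
      intro h
      rw [h, sub_zero, hu] at hdist
      nlinarith
    refine ⟨‖g k‖⁻¹ • g k, Finset.mem_image.2 ⟨g k, Finset.mem_filter.2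
      ⟨Finset.mem_image_of_mem g hk, hg0⟩, rfl⟩, ?_⟩
    have h2 := norm_sub_inv_norm_smul_le hu hg0
    calc _ ≤ (2 * ‖u - g k‖) ^ 2 * ((K : ℝ) ^ 2 * n) := by gcongr
      _ = 4 * (‖u - g k‖ ^ 2 * ((K : ℝ) ^ 2 * n)) := by ring
      _ ≤ 4 := by linarith

end Net

/-! ### Reduction to counts over unit vectors -/

section Deterministic

variable {m : ℕ} {E : Type*} [NormedAddCommGroup E] [InnerProductSpace ℝ E]

/-- Markov's inequality for the squares, with Cauchy–Schwarz row by row. -/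
lemma sq_mul_card_filter_lt_abs_inner_le (b : Fin m → E) (v : E) {η : ℝ} (hη : 0 ≤ η) :
    η ^ 2 * (Finset.univ.filter fun i => η < |inner ℝ (b i) v|).card ≤
      (∑ i, ‖b i‖ ^ 2) * ‖v‖ ^ 2 := by
  calc η ^ 2 * ((Finset.univ.filter fun i => η < |inner ℝ (b i) v|).card : ℝ)
      = ∑ i ∈ Finset.univ.filter fun i => η < |inner ℝ (b i) v|, η ^ 2 := by
        simp [mul_comm]
    _ ≤ ∑ i ∈ Finset.univ.filter fun i => η < |inner ℝ (b i) v|, (‖b i‖ * ‖v‖) ^ 2 := by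
        refine Finset.sum_le_sum fun i hi => ?_
        have h := (Finset.mem_filter.1 hi).2.le.trans (abs_real_inner_le_norm _ _)
        gcongr
    _ ≤ ∑ i, (‖b i‖ * ‖v‖) ^ 2 :=
        Finset.sum_le_sum_of_subset_of_nonneg (Finset.filter_subset _ _) fun _ _ _ => sq_nonneg _
    _ = _ := by simp_rw [mul_pow]; rw [Finset.sum_mul]

lemma card_filter_abs_inner_le_add (b : Fin m → E) (u w : E) (t η : ℝ) :
    (Finset.univ.filter fun i => |inner ℝ (b i) u| ≤ t).card ≤
      (Finset.univ.filter fun i => |inner ℝ (b i) w| ≤ t + η).card +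
      (Finset.univ.filter fun i => η < |inner ℝ (b i) (u - w)|).card := by
  classical
  refine (Finset.card_le_card fun i hi => ?_).trans (Finset.card_union_le _ _)
  simp only [Finset.mem_union, Finset.mem_filter, Finset.mem_univ, true_and] at hi ⊢
  by_contra! h
  rw [inner_sub_right] at h
  have := abs_sub_abs_le_abs_sub (inner ℝ (b i) w) (inner ℝ (b i) u)
  rw [abs_sub_comm] at this
  linarith

lemma abs_abs_sub_abs_eq_min (x y : ℝ) : |(|x| - |y|)| = min |x - y| |x + y| := by
  grind

lemma abs_inner_inv_norm_smul (b v : E) :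
    |inner ℝ b (‖v‖⁻¹ • v)| = |inner ℝ b v| / ‖v‖ := by
  rw [inner_smul_right, abs_mul, abs_inv, abs_norm, inv_mul_eq_div]

/-- The constants fit because `0.5 / 21 < 0.024` and `0.43 + 0.05 = 0.48 < p`. -/
lemma sampleQuantile_abs_abs_inner_sub_mem (hm : 0 < m) (b : Fin m → E)
    (hA : ∀ u : E, ‖u‖ = 1 →
      ((Finset.univ.filter fun i => |inner ℝ (b i) u| ≤ 0.5).card : ℝ) ≤ 0.43 * m)
    (hB : ∀ u : E, ‖u‖ = 1 →
      ((Finset.univ.filter fun i => |inner ℝ (b i) u| ≤ 0.024).card : ℝ) ≤ 0.05 * m)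
    (hC : ∀ u : E, ‖u‖ = 1 →
      0.51 * m ≤ ((Finset.univ.filter fun i => |inner ℝ (b i) u| ≤ 0.8).card : ℝ))
    {z x : E} (hzx : ‖z - x‖ < (1 / 11) * ‖z‖) {p : ℝ} (hp : 0.48 < p) (hp' : p ≤ 0.51) :
    0.5 * ‖z - x‖ ≤ sampleQuantile (fun i => |(|inner ℝ (b i) z| - |inner ℝ (b i) x|)|) p ∧
      sampleQuantile (fun i => |(|inner ℝ (b i) z| - |inner ℝ (b i) x|)|) p ≤
        0.8 * ‖z - x‖ := by
  have hm' : (0 : ℝ) < m := by exact_mod_cast hm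
  have hmin (i : Fin m) : |(|inner ℝ (b i) z| - |inner ℝ (b i) x|)| =
      min |inner ℝ (b i) (z - x)| |inner ℝ (b i) (z + x)| := by
    rw [abs_abs_sub_abs_eq_min, inner_sub_right, inner_add_right]
  simp_rw [hmin]
  have hnn (i : Fin m) : 0 ≤ min |inner ℝ (b i) (z - x)| |inner ℝ (b i) (z + x)| := by positivity
  have hz : 0 < ‖z‖ := by linarith [norm_nonneg (z - x)]
  have h2z : 2 * ‖z‖ ≤ ‖z + x‖ + ‖z - x‖ := by
    have h : (2 : ℝ) • z = (z + x) + (z - x) := by rw [two_smul]; abel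
    calc 2 * ‖z‖ = ‖(2 : ℝ) • z‖ := by simp [norm_smul]
      _ ≤ _ := h ▸ norm_add_le _ _
  have hadd : 21 * ‖z - x‖ ≤ ‖z + x‖ := by linarith
  have hadd0 : 0 < ‖z + x‖ := by linarith
  have hunit {v : E} (hv : 0 < ‖v‖) : ‖‖v‖⁻¹ • v‖ = 1 := by
    rw [norm_smul, norm_inv, norm_norm, inv_mul_cancel₀ hv.ne']
  rcases (norm_nonneg (z - x)).eq_or_lt with h0 | h0
  -- For `z = x` there is no direction to normalise, but all samples vanish.
  · rw [← h0]
    have hzero : z - x = 0 := norm_eq_zero.1 h0.symm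
    simp only [hzero, inner_zero_right, abs_zero]
    refine ⟨le_sampleQuantile hm (by linarith) fun s hs => ?_,
      sampleQuantile_le (by simp) (by linarith) ?_⟩
    · rw [empiricalCDF_eq_card_filter, Finset.filter_false_of_mem]
      · simp; linarith
      · intro i _
        rw [min_eq_left (abs_nonneg _)]
        linarith
    · rw [empiricalCDF_eq_card_filter, Finset.filter_true_of_mem]
      · simp [hm.ne']; linarith
      · intro i _
        rw [min_eq_left (abs_nonneg _)]
        simp
  constructor
  · refine le_sampleQuantile hm (by linarith) fun s hs => ?_
    rw [empiricalCDF_eq_card_filter, div_lt_iff₀ hm']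
    have hcard : (Finset.univ.filter fun i =>
        min |inner ℝ (b i) (z - x)| |inner ℝ (b i) (z + x)| ≤ s).card ≤
        (Finset.univ.filter fun i => |inner ℝ (b i) (‖z - x‖⁻¹ • (z - x))| ≤ 0.5).card +
        (Finset.univ.filter fun i => |inner ℝ (b i) (‖z + x‖⁻¹ • (z + x))| ≤ 0.024).card := by
      classical
      refine (Finset.card_le_card fun i hi => ?_).trans (Finset.card_union_le _ _)
      simp only [Finset.mem_union, Finset.mem_filter, Finset.mem_univ, true_and,
        abs_inner_inv_norm_smul, div_le_iff₀ h0, div_le_iff₀ hadd0] at hi ⊢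
      rcases min_le_iff.1 hi with h | h
      · left; linarith
      · right; linarith
    have hcard' : ((Finset.univ.filter fun i =>
        min |inner ℝ (b i) (z - x)| |inner ℝ (b i) (z + x)| ≤ s).card : ℝ) ≤ 0.43 * m + 0.05 * m :=
      le_trans (by exact_mod_cast hcard) (add_le_add (hA _ (hunit h0)) (hB _ (hunit hadd0)))
    nlinarith
  · refine sampleQuantile_le hnn (by linarith) ?_
    rw [empiricalCDF_eq_card_filter, le_div_iff₀ hm']
    have hcard : (Finset.univ.filter fun i =>
        |inner ℝ (b i) (‖z - x‖⁻¹ • (z - x))| ≤ 0.8).card ≤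
        (Finset.univ.filter fun i =>
          min |inner ℝ (b i) (z - x)| |inner ℝ (b i) (z + x)| ≤ 0.8 * ‖z - x‖).card := by
      refine Finset.card_le_card fun i hi => ?_
      simp only [Finset.mem_filter, Finset.mem_univ, true_and,
        abs_inner_inv_norm_smul, div_le_iff₀ h0] at hi ⊢
      exact (min_le_left _ _).trans hi
    have hcard' := (hC _ (hunit h0)).trans (Nat.cast_le.2 hcard)
    nlinarith

end Deterministic

/-! ### Union bound and conclusion -/

section Main

/-- For `n ≥ 2`, `8000 n + 1 ≤ 2 ^ 13 * n ≤ n ^ 14`. The factor 8001 serves `n = 1`, where the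
logarithm vanishes. -/
lemma grid_card_le {n : ℕ} (hn : 0 < n) :
    ((2 * (4000 * n) + 1 : ℕ) ^ n : ℝ) ≤ 8001 * Real.exp (14 * (n * Real.log n)) := by
  rcases (show 1 ≤ n from hn).eq_or_lt with rfl | h2
  · norm_num
  have hn2 : (2 : ℝ) ≤ n := by exact_mod_cast h2
  have hbase : ((2 * (4000 * n) + 1 : ℕ) : ℝ) ≤ (n : ℝ) ^ 14 := by
    have h13 : (2 : ℝ) ^ 13 ≤ (n : ℝ) ^ 13 := by gcongr
    push_cast
    nlinarith
  have hexp : Real.exp (14 * (n * Real.log n)) = ((n : ℝ) ^ 14) ^ n := by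
    rw [← pow_mul, ← Real.exp_log (show (0 : ℝ) < n by linarith), ← Real.exp_nat_mul,
      Real.exp_log (by linarith)]
    push_cast
    ring_nf
  rw [hexp]
  calc _ ≤ ((n : ℝ) ^ 14) ^ n := by gcongr
    _ ≤ _ := le_mul_of_one_le_left (by positivity) (by norm_num)

lemma card_filter_abs_inner_bounds {m n : ℕ} {b : Fin m → EuclideanSpace ℝ (Fin n)}
    {N : Finset (EuclideanSpace ℝ (Fin n))} (hn : 0 < n)
    (hN : ∀ u : EuclideanSpace ℝ (Fin n), ‖u‖ = 1 →
        ∃ w ∈ N, ‖u - w‖ ^ 2 * (((4000 : ℕ) : ℝ) ^ 2 * n) ≤ 4)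
    (hb : ∑ i, ‖b i‖ ^ 2 ≤ 4 * ((m : ℝ) * n)) {u : EuclideanSpace ℝ (Fin n)} (hu : ‖u‖ = 1) :
    ∃ w ∈ N,
      (∀ t : ℝ, ((Finset.univ.filter fun i => |inner ℝ (b i) u| ≤ t).card : ℝ) ≤
        (Finset.univ.filter fun i => |inner ℝ (b i) w| ≤ t + 0.01).card + 0.01 * m) ∧
      (∀ t : ℝ, ((Finset.univ.filter fun i => |inner ℝ (b i) w| ≤ t).card : ℝ) ≤
        (Finset.univ.filter fun i => |inner ℝ (b i) u| ≤ t + 0.01).card + 0.01 * m) := by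
  obtain ⟨w, hw, hd⟩ := hN u hu
  have hn' : (0 : ℝ) < n := by exact_mod_cast hn
  have far {v : EuclideanSpace ℝ (Fin n)}
      (hv : ‖v‖ ^ 2 * (((4000 : ℕ) : ℝ) ^ 2 * n) ≤ 4) :
      ((Finset.univ.filter fun i => 0.01 < |inner ℝ (b i) v|).card : ℝ) ≤ 0.01 * m := by
    -- The mesh constant 4000 is exactly enough: `4 · 4 / 4000² = 0.01² · 0.01`.
    have h1 := sq_mul_card_filter_lt_abs_inner_le b v (η := 0.01) (by norm_num)
    have h2 : (∑ i, ‖b i‖ ^ 2) * ‖v‖ ^ 2 ≤ 4 * ((m : ℝ) * n) * ‖v‖ ^ 2 := by gcongr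
    have h3 : (m : ℝ) * (‖v‖ ^ 2 * (((4000 : ℕ) : ℝ) ^ 2 * n)) ≤ m * 4 := by gcongr
    push_cast at h3
    nlinarith
  refine ⟨w, hw, fun t => ?_, fun t => ?_⟩
  · have := card_filter_abs_inner_le_add b u w t 0.01
    refine le_trans (Nat.cast_le.2 this) ?_
    push_cast
    gcongr
    exact far hd
  · have := card_filter_abs_inner_le_add b w u t 0.01
    refine le_trans (Nat.cast_le.2 this) ?_
    push_cast
    gcongr
    exact far (by rwa [norm_sub_rev])

open Classical in
/-- The event that some direction of the net `N` has an atypical number of small inner products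
with the rows, or that the rows are atypically large. -/
def atypicalEvent {Ω : Type*} {m n : ℕ} (a : Fin m → Ω → EuclideanSpace ℝ (Fin n))
    (N : Finset (EuclideanSpace ℝ (Fin n))) : Set Ω :=
  {ω | 4 * ((m : ℝ) * n) ≤ ∑ i, ‖a i ω‖ ^ 2} ∪ ⋃ w ∈ N,
    ({ω | (0.408 + 0.01) * (m : ℝ) ≤
        (Finset.univ.filter fun i => inner ℝ (a i ω) w ∈ Set.Icc (-0.51 : ℝ) 0.51).card} ∪
      {ω | (0.0272 + 0.01) * (m : ℝ) ≤
        (Finset.univ.filter fun i => inner ℝ (a i ω) w ∈ Set.Icc (-0.034 : ℝ) 0.034).card} ∪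
      {ω | (0.45 + 0.01) * (m : ℝ) ≤
        (Finset.univ.filter fun i => inner ℝ (a i ω) w ∈ (Set.Icc (-0.79 : ℝ) 0.79)ᶜ).card})

lemma IsStdGaussianDesign.measure_atypicalEvent_le {Ω : Type*} [MeasurableSpace Ω] {P : Measure Ω}
    [IsProbabilityMeasure P] {m n : ℕ} {a : Fin m → Ω → EuclideanSpace ℝ (Fin n)}
    (ha : IsStdGaussianDesign P a) {N : Finset (EuclideanSpace ℝ (Fin n))}
    (hN : ∀ w ∈ N, ‖w‖ = 1) :
    P.real (atypicalEvent a N) ≤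
      Real.exp (-((m : ℝ) * n) / 2) + N.card * (3 * Real.exp (-2 * 0.01 ^ 2 * (m : ℝ))) := by
  classical
  refine (measureReal_union_le _ _).trans (add_le_add ha.measure_sum_norm_sq_ge_le ?_)
  refine (measureReal_biUnion_finset_le _ _).trans ?_
  rw [← nsmul_eq_mul]
  refine Finset.sum_le_card_nsmul _ _ _ fun w hw => ?_
  have hlaw := ha.hasLaw_inner (hN w hw)
  have hind := ha.iIndepFun_inner w
  have h1 := measure_card_filter_mem_ge_le hlaw hind (S := Set.Icc (-0.51) 0.51)
    measurableSet_Icc (p := 0.408) (ε := 0.01)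
    ((gaussianReal_Icc_symm_le (by norm_num)).trans (by norm_num)) (by norm_num)
  have h2 := measure_card_filter_mem_ge_le hlaw hind (S := Set.Icc (-0.034) 0.034)
    measurableSet_Icc (p := 0.0272) (ε := 0.01)
    ((gaussianReal_Icc_symm_le (by norm_num)).trans (by norm_num)) (by norm_num)
  have h3 := measure_card_filter_mem_ge_le hlaw hind (S := (Set.Icc (-0.79) 0.79)ᶜ)
    measurableSet_Icc.compl (p := 0.45) (ε := 0.01) gaussianReal_compl_Icc_le (by norm_num)
  refine (measureReal_union_le _ _).trans
    ((add_le_add (measureReal_union_le _ _) le_rfl).trans ?_)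
  have h : 3 * Real.exp (-2 * 0.01 ^ 2 * (m : ℝ)) = Real.exp (-2 * 0.01 ^ 2 * (m : ℝ)) +
      Real.exp (-2 * 0.01 ^ 2 * (m : ℝ)) + Real.exp (-2 * 0.01 ^ 2 * (m : ℝ)) := by ring
  rw [h]
  refine add_le_add (add_le_add ?_ ?_) ?_
  · convert h1
  · convert h2
  · convert h3

lemma sampleQuantile_mem_of_notMem_atypicalEvent {Ω : Type*} {m n : ℕ} (hm : 0 < m) (hn : 0 < n)
    {a : Fin m → Ω → EuclideanSpace ℝ (Fin n)} {N : Finset (EuclideanSpace ℝ (Fin n))}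
    (hN : ∀ u : EuclideanSpace ℝ (Fin n), ‖u‖ = 1 →
        ∃ w ∈ N, ‖u - w‖ ^ 2 * (((4000 : ℕ) : ℝ) ^ 2 * n) ≤ 4)
    {ω : Ω} (hω : ω ∉ atypicalEvent a N)
    {z x : EuclideanSpace ℝ (Fin n)} (hzx : ‖z - x‖ < (1 / 11) * ‖z‖) {p : ℝ} (hp : 0.48 < p)
    (hp' : p ≤ 0.51) :
    0.5 * ‖z - x‖ ≤
        sampleQuantile (fun i => |(|inner ℝ (a i ω) z| - |inner ℝ (a i ω) x|)|) p ∧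
      sampleQuantile (fun i => |(|inner ℝ (a i ω) z| - |inner ℝ (a i ω) x|)|) p ≤
        0.8 * ‖z - x‖ := by
  classical
  simp only [atypicalEvent, Set.mem_union, Set.mem_iUnion, Set.mem_ofPred_eq, not_or, not_exists,
    not_le] at hω
  obtain ⟨hsum, hnet⟩ := hω
  have hm' : (0 : ℝ) < m := by exact_mod_cast hm
  have hmem (s y : ℝ) : y ∈ Set.Icc (-s) s ↔ |y| ≤ s := by rw [Set.mem_Icc, abs_le]
  have hbd {u : EuclideanSpace ℝ (Fin n)} (hu : ‖u‖ = 1) :=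
    card_filter_abs_inner_bounds hn hN hsum.le hu
  refine sampleQuantile_abs_abs_inner_sub_mem hm _ (fun u hu => ?_) (fun u hu => ?_)
    (fun u hu => ?_) hzx hp hp'
  · obtain ⟨w, hw, h, -⟩ := hbd hu
    have h1 := h 0.5
    have h2 := (hnet w hw).1.1
    simp only [hmem] at h2
    norm_num at h1 h2 ⊢
    linarith
  · obtain ⟨w, hw, h, -⟩ := hbd hu
    have h1 := h 0.024
    have h2 := (hnet w hw).1.2
    simp only [hmem] at h2
    norm_num at h1 h2 ⊢
    linarith
  · obtain ⟨w, hw, -, h⟩ := hbd hu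
    have h1 := h 0.79
    have h2 := (hnet w hw).2
    simp only [hmem, Set.mem_compl_iff] at h2
    have h3 := Finset.card_filter_add_card_filter_not (s := (Finset.univ : Finset (Fin m)))
      fun i => |inner ℝ (a i ω) w| ≤ 0.79
    have h4 := congrArg (Nat.cast (R := ℝ)) h3
    push_cast [Finset.card_univ, Fintype.card_fin] at h4
    norm_num at h1 h2 h4 ⊢
    linarith

end Main

theorem proposition6 :
    ∃ c₀ c₁ c₂ : ℝ, 0 < c₀ ∧ 0 < c₁ ∧ 0 < c₂ ∧
      ∀ (n m : ℕ), c₀ * (n : ℝ) * Real.log (n : ℝ) < (m : ℝ) →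
        ∀ (Ω : Type*) [MeasurableSpace Ω] (P : Measure Ω) [IsProbabilityMeasure P]
          (a : Fin m → Ω → EuclideanSpace ℝ (Fin n)), IsStdGaussianDesign P a →
          ∃ E : Set Ω, MeasurableSet E ∧ 1 - c₁ * Real.exp (-c₂ * (m : ℝ)) ≤ P.real E ∧
            ∀ ω ∈ E, ∀ z x : EuclideanSpace ℝ (Fin n), ‖z - x‖ < (1 / 11) * ‖z‖ →
              ∀ p ∈ ({0.49, 0.5, 0.51} : Set ℝ),
                0.5 * ‖z - x‖ ≤
                    sampleQuantile (fun i => |(|inner ℝ (a i ω) z| - |inner ℝ (a i ω) x|)|) p ∧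
                  sampleQuantile (fun i => |(|inner ℝ (a i ω) z| - |inner ℝ (a i ω) x|)|) p ≤
                    0.8 * ‖z - x‖ := by
  -- Hoeffding gives `exp(-m / 5000)`; half the exponent absorbs `14 n log n < m / 10000`. The
  -- prefactor is `3 · 8001`, plus 1 for the row norms.
  refine ⟨140000, 24004, 1 / 10000, by norm_num, by norm_num, by norm_num, ?_⟩
  intro n m hnm Ω _ P _ a ha
  rcases Nat.eq_zero_or_pos n with rfl | hn
  · refine ⟨Set.univ, MeasurableSet.univ, ?_, fun ω _ z x hzx => ?_⟩
    · rw [probReal_univ]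
      linarith [Real.exp_pos (-(1 / 10000) * (m : ℝ))]
    · rw [Subsingleton.elim z 0, Subsingleton.elim x 0] at hzx
      simp at hzx
  have hn1 : (1 : ℝ) ≤ n := by exact_mod_cast hn
  have hlog : 0 ≤ Real.log n := Real.log_nonneg hn1
  have hm : 0 < m := by
    have : (0 : ℝ) < m := lt_of_le_of_lt (by positivity) hnm
    exact_mod_cast this
  obtain ⟨N, hcard, hunit, hnet⟩ := exists_finset_net_sphere (n := n) (K := 4000) (by norm_num) hn
  have hcard' : (N.card : ℝ) ≤ 8001 * Real.exp (14 * (n * Real.log n)) :=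
    le_trans (by exact_mod_cast hcard) (grid_card_le hn)
  -- The rows are only a.e. measurable, so the bad event is replaced by a measurable hull of equal
  -- measure.
  refine ⟨(toMeasurable P (atypicalEvent a N))ᶜ, (measurableSet_toMeasurable _ _).compl, ?_,
    fun ω hω z x hzx p hp => ?_⟩
  · rw [probReal_compl_eq_one_sub (measurableSet_toMeasurable _ _), measureReal_def,
      measure_toMeasurable, ← measureReal_def]
    have h1 : Real.exp (-((m : ℝ) * n) / 2) ≤ Real.exp (-(1 / 10000) * (m : ℝ)) :=
      Real.exp_le_exp.2 (by nlinarith [Nat.cast_nonneg (α := ℝ) m])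
    have h2 : N.card * (3 * Real.exp (-2 * 0.01 ^ 2 * (m : ℝ))) ≤
        24003 * Real.exp (-(1 / 10000) * (m : ℝ)) :=
      calc _ ≤ 8001 * Real.exp (14 * (n * Real.log n)) *
            (3 * Real.exp (-2 * 0.01 ^ 2 * (m : ℝ))) := by gcongr
        _ = 24003 * Real.exp (14 * (n * Real.log n) + -2 * 0.01 ^ 2 * (m : ℝ)) := by
          rw [Real.exp_add]
          ring
        _ ≤ _ := by
          gcongr
          linarith
    linarith [ha.measure_atypicalEvent_le hunit]
  · have hp2 : 0.48 < p ∧ p ≤ 0.51 := by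
      rcases hp with rfl | rfl | rfl <;> norm_num
    exact sampleQuantile_mem_of_notMem_atypicalEvent hm hn hnet
      (fun h => hω (subset_toMeasurable _ _ h)) hzx hp2.1 hp2.2
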